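/- Let $N\ge 1$, let $\mathcal E_1\le\dots\le\mathcal E_N$ be real numbers (energy levels) with $\sum_k\mathcal E_k=0$, let $A=-i\,\mathrm{diag}(\mathcal E_1,\dots,\mathcal E_N)$, and let $B=(b_{ij})\in\mathfrak{su}(N)$ (the traceless skew-Hermitian complex $N\times N$ matrices). Consider the control system on $SU(N)$ $$\dot X(t)=(A+u(t)B)X(t),\qquad X(0)=I,$$ with real-valued piecewise constant inputs $u$. It is called controllable if for every $\bar X\in SU(N)$ there are a time $T\ge 0$ and an input $u$ whose solution satisfies $X(T)=\bar X$. Let $\mathcal G_B$ be the graph on $\{1,\dots,N\}$ in which $i\ne j$ are joined exactly when $b_{ij}\neq 0$, let $B_0=\mathrm{diag}(b_{11},\dots,b_{NN})$ be the diagonal part of $B$, and let $C=[A,B]=(c_{ij})$. For a diagonal matrix $D=\mathrm{diag}(d_1,\dots,d_N)$ put $\alpha_{ij}(D)=d_i-d_j$. Call $D$ regular if $\alpha_{ij}(D)\neq\alpha_{kl}(D)$ whenever $i\ne j$, $k\ne l$ and $(i,j)\neq(k,l)$; call $D$ $C$-regular if the numbers $\alpha_{ij}(D)$, for the pairs $i<j$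 with $c_{ij}\neq 0$, are nonzero and pairwise distinct (that is, distinct pairs give distinct numbers). Theorem. Suppose that $\mathcal E_i\ne\mathcal E_j$ for $i\neq j$ and that $\mathcal G_B$ is connected. Then either of the following conditions is sufficient for controllability of the system: (1) $B_0$ is regular; (2) $B_0$ is $C$-regular. -/

import Mathlib

open scoped Matrix Topology

/-- The real Lie algebra `su(N)`: traceless skew-Hermitian complex `N × N` matrices. -/
def su (N : ℕ) : Set (Matrix (Fin N) (Fin N) ℂ) :=
  {M | Mᴴ = -M ∧ M.trace = 0}

/-- The drift `A = -i H₀` of the system with energy levels `E₁, …, E_N`, where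
`H₀ = diag(E₁, …, E_N)` is the internal Hamiltonian. -/
noncomputable def drift {N : ℕ} (E : Fin N → ℝ) : Matrix (Fin N) (Fin N) ℂ :=
  (-Complex.I) • Matrix.diagonal (fun k => (E k : ℂ))

/-- The diagonal part `B₀` of a matrix `B`. -/
def diagPart {N : ℕ} (B : Matrix (Fin N) (Fin N) ℂ) : Matrix (Fin N) (Fin N) ℂ :=
  Matrix.diagonal (fun k => B k k)

/-- The graph of a square matrix `M` (loops dropped): `i` and `j` are joined when `i ≠ j` and
`M i j ≠ 0` or `M j i ≠ 0`. For a skew-Hermitian matrix these two conditions are equivalent, so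
that connectivity and strong connectivity (of the directed graph) coincide. -/
def matrixGraph {N : ℕ} (M : Matrix (Fin N) (Fin N) ℂ) : SimpleGraph (Fin N) :=
  SimpleGraph.fromRel (fun i j => M i j ≠ 0)

/-- The value at the diagonal matrix `D` of the root `α_{ij} = α_i - α_j`. The root is positive
when `i < j`. -/
def rootValue {N : ℕ} (i j : Fin N) (D : Matrix (Fin N) (Fin N) ℂ) : ℂ :=
  D i i - D j j

/-- A diagonal matrix `D` is regular when all roots take pairwise distinct values at `D`.
As `α_{ji} = -α_{ij}`, no root vanishes at a regular element. -/
def IsRegularDiag {N : ℕ} (D : Matrix (Fin N) (Fin N) ℂ) : Prop :=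
  ∀ i j k l : Fin N, i ≠ j → k ≠ l → (i, j) ≠ (k, l) → rootValue i j D ≠ rootValue k l D

/-- The set `Γ⁺` of the positive roots `α_{ij}`, `i < j`, that occur in `M`. -/
def positiveSupport {N : ℕ} (M : Matrix (Fin N) (Fin N) ℂ) : Set (Fin N × Fin N) :=
  {p | p.1 < p.2 ∧ M p.1 p.2 ≠ 0}

/-- A diagonal matrix `D` is `M`-regular when the values at `D` of the positive roots occurring
in `M` are nonzero and pairwise distinct. -/
def IsRegularAlong {N : ℕ} (D M : Matrix (Fin N) (Fin N) ℂ) : Prop :=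
  (∀ p ∈ positiveSupport M, rootValue p.1 p.2 D ≠ 0) ∧
    ∀ p ∈ positiveSupport M, ∀ q ∈ positiveSupport M, p ≠ q →
      rootValue p.1 p.2 D ≠ rootValue q.1 q.2 D

/-- `X` is, on `[0, T]`, the integral curve in `SU(N)` with `X(0) = 1` of
`X' = (A + u(t) B) X` for the input `u`, which is piecewise constant on `[0, T]`: away from a
finite set `F` of times, `u` is locally constant and the equation holds (entry by entry). -/
def IsTrajectory {N : ℕ} (A B : Matrix (Fin N) (Fin N) ℂ) (T : ℝ) (u : ℝ → ℝ)
    (X : ℝ → Matrix.specialUnitaryGroup (Fin N) ℂ) : Prop :=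
  X 0 = 1 ∧ ContinuousOn X (Set.Icc 0 T) ∧
    ∃ F : Finset ℝ, ∀ s ∈ Set.Ioo 0 T, s ∉ F →
      (∀ᶠ r in 𝓝 s, u r = u s) ∧
      ∀ i j : Fin N,
        HasDerivAt (fun r => (X r : Matrix (Fin N) (Fin N) ℂ) i j)
          (((A + u s • B) * (X s : Matrix (Fin N) (Fin N) ℂ)) i j) s

/-- The set of points of `SU(N)` reachable from the identity at some time `T ≥ 0`. -/
def reachableSet {N : ℕ} (A B : Matrix (Fin N) (Fin N) ℂ) :
    Set (Matrix.specialUnitaryGroup (Fin N) ℂ) :=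
  {Y | ∃ T : ℝ, 0 ≤ T ∧ ∃ (u : ℝ → ℝ) (X : ℝ → Matrix.specialUnitaryGroup (Fin N) ℂ),
    IsTrajectory A B T u X ∧ X T = Y}

/-- Global controllability: the reachable set is all of `SU(N)`. -/
def IsControllable {N : ℕ} (A B : Matrix (Fin N) (Fin N) ℂ) : Prop :=
  reachableSet A B = Set.univ

/-! ### Algebra: the Lie algebra generated by drift and control -/

section

open Matrix

/-! Concatenating constant inputs reaches the semigroup S generated by exp(t(A + vB)), t ≥ 0, so it
is enough that S = SU(N).

Algebra (`su_subset_of_ad_invariant`). Complexify the Lie algebra generated by A and B. Spectral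
projections of ad A extract B₀ from B, because the energies are distinct; projections of ad A and
then ad B₀ isolate each matrix unit e_ij with b_ij ≠ 0. Here the sign of E_i - E_j separates
positive roots from negative ones, which is why regularity is needed among positive roots only.
Brackets along paths of the connected graph give every off-diagonal e_ij, hence all traceless
matrices; taking skew-Hermitian parts returns su(N).

Semigroup (`expSemigroup_eq_top`). The span of the conjugates sMs⁻¹, with s in S and M = A + vB, is
invariant under each ad M, so it contains su(N). A map into S of greatest rank has a derivative
whose range contains the translates of all these conjugates (`mul_conj_mem_range`), so S has an
interior point. By compactness the closure of S is a group, which moves the interior point to the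
identity. Since exp maps su(N) onto SU(N), every element is a power of one close to 1. -/

/-- A subspace invariant under the bracket with a diagonal matrix contains the components of its
elements in the eigenspaces of that bracket. -/
theorem eigencomponent_mem {n : Type*} [Fintype n] [DecidableEq n]
    (W : Submodule ℂ (Matrix n n ℂ)) (d : n → ℂ)
    (hW : ∀ X ∈ W, ⁅diagonal d, X⁆ ∈ W) {X : Matrix n n ℂ} (hX : X ∈ W) (c : ℂ) :
    (Matrix.of fun i j => if d i - d j = c then X i j else 0) ∈ W := by
  -- ad (diagonal d) scales entry (i, j) by d i - d j, so these are the values at X of the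
  -- polynomials ∏ (ad - μ).
  have key : ∀ s : Finset ℂ,
      (Matrix.of fun i j => (∏ μ ∈ s, (d i - d j - μ)) * X i j) ∈ W := by
    intro s
    induction s using Finset.induction_on with
    | empty =>
      convert hX using 1
      ext i j
      simp
    | insert a s ha ih =>
      have := W.sub_mem (hW _ ih) (W.smul_mem a ih)
      convert this using 1
      ext i j
      simp [Finset.prod_insert ha, Ring.lie_def, diagonal_mul, mul_diagonal]
      ring
  classical
  -- All eigenvalues except c: the product, divided by its value at c, is the Lagrange projector
  -- onto the c-eigenspace.
  set s : Finset ℂ := (Finset.univ.image fun p : n × n => d p.1 - d p.2).erase c with hs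
  have hne : ∏ μ ∈ s, (c - μ) ≠ 0 := by
    rw [Finset.prod_ne_zero_iff]
    intro μ hμ h
    exact (Finset.ne_of_mem_erase hμ) (sub_eq_zero.1 h).symm
  have := W.smul_mem (∏ μ ∈ s, (c - μ))⁻¹ (key s)
  convert this using 1
  ext i j
  by_cases h : d i - d j = c
  · simp [h, hne]
  · have h0 : ∏ μ ∈ s, (d i - d j - μ) = 0 := by
      apply Finset.prod_eq_zero (i := d i - d j)
      · simp only [hs, Finset.mem_erase, Finset.mem_image, Finset.mem_univ, true_and]
        exact ⟨h, (i, j), rfl⟩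
      · simp
    simp [h, h0]

/-- A complex Lie algebra of matrices that contains the matrix units of the edges of a connected
graph contains all traceless matrices. -/
theorem mem_of_trace_eq_zero_of_connected {n : Type*} [Fintype n] [DecidableEq n]
    (W : Submodule ℂ (Matrix n n ℂ)) (hW : ∀ X ∈ W, ∀ Y ∈ W, ⁅X, Y⁆ ∈ W)
    (G : SimpleGraph n) (hG : G.Connected) (hadj : ∀ i j, G.Adj i j → single i j (1 : ℂ) ∈ W)
    (X : Matrix n n ℂ) (hX : X.trace = 0) : X ∈ W := by
  have hoff : ∀ i j, i ≠ j → single i j (1 : ℂ) ∈ W := by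
    intro i j
    have hr := (SimpleGraph.reachable_iff_reflTransGen i j).1 (hG.preconnected i j)
    induction hr with
    | refl => exact fun h => absurd rfl h
    | @tail j k hij hjk ih =>
      intro hik
      by_cases h : i = j
      · subst h
        exact hadj _ _ hjk
      · have := hW _ (ih h) _ (hadj _ _ hjk)
        rwa [Ring.lie_def, single_mul_single_same,
          single_mul_single_of_ne (h := fun h => hik h.symm), sub_zero, one_mul] at this
  have hdiag : ∀ i j, single i i (1 : ℂ) - single j j 1 ∈ W := by
    intro i j
    by_cases h : i = j
    · simp [h]
    · have := hW _ (hoff i j h) _ (hoff j i (Ne.symm h))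
      rwa [Ring.lie_def, single_mul_single_same, single_mul_single_same, one_mul] at this
  obtain ⟨i₀⟩ := hG.nonempty
  -- The subtracted multiples of the unit at (i₀, i₀) add up to the trace, which is zero.
  have hsum : X = ∑ i, ∑ j, X i j • (single i j (1 : ℂ) - if i = j then single i₀ i₀ 1 else 0) := by
    have h1 : ∑ i, ∑ j, X i j • (if i = j then single i₀ i₀ (1 : ℂ) else 0) = 0 := by
      have : ∀ i, ∑ j, X i j • (if i = j then single i₀ i₀ (1 : ℂ) else 0)
          = X i i • single i₀ i₀ (1 : ℂ) := by
        intro i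
        simp [smul_ite]
      simp_rw [this]
      rw [← Finset.sum_smul, show ∑ i, X i i = 0 from hX, zero_smul]
    simp_rw [smul_sub, Finset.sum_sub_distrib]
    rw [h1, sub_zero]
    simpa using matrix_eq_sum_single X
  rw [hsum]
  refine W.sum_mem fun i _ => W.sum_mem fun j _ => W.smul_mem _ ?_
  by_cases h : i = j
  · subst h
    simpa using hdiag i i₀
  · simpa [h] using hoff i j h

theorem drift_eq_diagonal {N : ℕ} (E : Fin N → ℝ) :
    drift E = diagonal fun k => -Complex.I * (E k : ℂ) := by
  ext i j
  by_cases h : i = j <;> simp [drift, h, diagonal]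

theorem lie_drift_apply {N : ℕ} (E : Fin N → ℝ) (B : Matrix (Fin N) (Fin N) ℂ) (i j : Fin N) :
    ⁅drift E, B⁆ i j = -Complex.I * (E i - E j) * B i j := by
  rw [drift_eq_diagonal, Ring.lie_def]
  simp [diagonal_mul, mul_diagonal]
  ring

theorem su_apply_eq {N : ℕ} {B : Matrix (Fin N) (Fin N) ℂ} (hB : B ∈ su N) (i j : Fin N) :
    B j i = -star (B i j) := by
  have h : star (B i j) = -B j i := congrFun (congrFun hB.1 j) i
  rw [h, neg_neg]

variable {N : ℕ} {E : Fin N → ℝ} {B : Matrix (Fin N) (Fin N) ℂ}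

/-- The complex Lie algebra generated by the drift and the control contains all traceless
matrices. -/
theorem mem_of_trace_eq_zero (hE : Monotone E) (hE' : ∀ i j, i ≠ j → E i ≠ E j)
    (hB : B ∈ su N) (hconn : (matrixGraph B).Connected)
    (hreg : IsRegularAlong (diagPart B) ⁅drift E, B⁆)
    (W : Submodule ℂ (Matrix (Fin N) (Fin N) ℂ)) (hW : ∀ X ∈ W, ∀ Y ∈ W, ⁅X, Y⁆ ∈ W)
    (hAW : drift E ∈ W) (hBW : B ∈ W) (X : Matrix (Fin N) (Fin N) ℂ) (hX : X.trace = 0) :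
    X ∈ W := by
  have hI : ∀ x y : ℂ, -Complex.I * x - -Complex.I * y = 0 ↔ x = y := by
    intro x y
    rw [← mul_sub, mul_eq_zero, sub_eq_zero]
    simp [Complex.I_ne_zero]
  have hEinj : Function.Injective E := fun i j h => by
    by_contra hij
    exact hE' i j hij h
  have hlt : ∀ {i j}, i < j → E i < E j := fun h => hE.strictMono_of_injective hEinj h
  have hB0 : diagPart B ∈ W := by
    have := eigencomponent_mem W _ (fun X hX => hW _ (drift_eq_diagonal E ▸ hAW) _ hX) hBW 0
    convert this using 1
    ext i j
    simp only [diagPart, of_apply, hI, Complex.ofReal_inj, hEinj.eq_iff, diagonal_apply]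
    by_cases h : i = j <;> simp [h]
  have hbsupp : ∀ {i j}, i < j → B i j ≠ 0 → (i, j) ∈ positiveSupport ⁅drift E, B⁆ := by
    intro i j hij hb
    refine ⟨hij, ?_⟩
    rw [lie_drift_apply]
    refine mul_ne_zero (mul_ne_zero (neg_ne_zero.2 Complex.I_ne_zero) ?_) hb
    rw [sub_ne_zero]
    exact_mod_cast (hlt hij).ne
  have hne : ∀ {i j}, B i j ≠ 0 → B j i ≠ 0 := by
    intro i j h
    rw [su_apply_eq hB i j]
    simpa using h
  have hr : ∀ i j, rootValue i j (diagPart B) = B i i - B j j := by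
    intro i j
    simp [rootValue, diagPart]
  have hunit : ∀ i j, i ≠ j → B i j ≠ 0 → single i j (1 : ℂ) ∈ W := by
    intro i j hij hb
    have h1 := eigencomponent_mem W _ (fun X hX => hW _ (drift_eq_diagonal E ▸ hAW) _ hX) hBW
      (-Complex.I * E i - -Complex.I * E j)
    have h2 := eigencomponent_mem W _ (fun X hX => hW _ hB0 _ hX) h1 (B i i - B j j)
    have h3 := W.smul_mem (B i j)⁻¹ h2
    convert h3 using 1
    ext k l
    by_cases hkl : i = k ∧ j = l
    · obtain ⟨rfl, rfl⟩ := hkl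
      simp [hb]
    · rw [single_apply_of_ne _ _ _ _ _ hkl]
      simp only [Matrix.smul_apply, of_apply]
      split_ifs with ha hc
      · by_cases hz : B k l = 0
        · simp [hz]
        exfalso
        have hc' : E k - E l = E i - E j := by
          rw [← mul_sub, ← mul_sub] at hc
          have := mul_left_cancel₀ (neg_ne_zero.2 Complex.I_ne_zero) hc
          exact_mod_cast this
        rcases lt_or_gt_of_ne hij with hlt1 | hlt1
        -- Equal energy gaps have equal signs, so (k, l) is a positive root too and regularity along
        -- C applies. In the other case both pairs are reversed.
        · have hkl2 : k < l := by
            by_contra hcon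
            have := hE (not_lt.1 hcon)
            have := hlt hlt1
            linarith
          refine hreg.2 (k, l) (hbsupp hkl2 hz) (i, j) (hbsupp hlt1 hb) ?_ ?_
          · rintro h
            simp only [Prod.mk.injEq] at h
            exact hkl ⟨h.1.symm, h.2.symm⟩
          · rw [hr, hr]
            exact ha
        · have hkl2 : l < k := by
            by_contra hcon
            have := hE (not_lt.1 hcon)
            have := hlt hlt1
            linarith
          refine hreg.2 (l, k) (hbsupp hkl2 (hne hz)) (j, i) (hbsupp hlt1 (hne hb)) ?_ ?_
          · rintro h
            simp only [Prod.mk.injEq] at h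
            exact hkl ⟨h.2.symm, h.1.symm⟩
          · rw [hr, hr]
            linear_combination -ha
      · simp
      · simp
  refine mem_of_trace_eq_zero_of_connected W hW _ hconn ?_ X hX
  intro i j hij
  rw [matrixGraph, SimpleGraph.fromRel_adj] at hij
  exact hunit i j hij.1 (hij.2.elim id hne)

/-- A real space of skew-Hermitian matrices that contains the drift and the control and is invariant
under the brackets with them contains `su N`. -/
theorem su_subset_of_ad_invariant (hE : Monotone E) (hE' : ∀ i j, i ≠ j → E i ≠ E j)
    (hB : B ∈ su N) (hconn : (matrixGraph B).Connected)
    (hreg : IsRegularAlong (diagPart B) ⁅drift E, B⁆)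
    (V : Submodule ℝ (Matrix (Fin N) (Fin N) ℂ)) (hV : ∀ X ∈ V, Xᴴ = -X)
    (hAV : drift E ∈ V) (hBV : B ∈ V) (hA : ∀ X ∈ V, ⁅drift E, X⁆ ∈ V)
    (hB' : ∀ X ∈ V, ⁅B, X⁆ ∈ V) : su N ⊆ V := by
  have br_add_left : ∀ X Y Z : Matrix (Fin N) (Fin N) ℂ, ⁅X + Y, Z⁆ = ⁅X, Z⁆ + ⁅Y, Z⁆ := by
    intro X Y Z
    simp only [Ring.lie_def]
    noncomm_ring
  have br_smul_left : ∀ (c : ℝ) (X Z : Matrix (Fin N) (Fin N) ℂ), ⁅c • X, Z⁆ = c • ⁅X, Z⁆ := by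
    intro c X Z
    simp only [Ring.lie_def, smul_mul_assoc, mul_smul_comm, smul_sub]
  have br_br : ∀ X Y Z : Matrix (Fin N) (Fin N) ℂ, ⁅⁅X, Y⁆, Z⁆ = ⁅X, ⁅Y, Z⁆⁆ - ⁅Y, ⁅X, Z⁆⁆ := by
    intro X Y Z
    simp only [Ring.lie_def]
    noncomm_ring
  -- V need not be closed under brackets. Its elements that normalize V form a Lie algebra, by the
  -- Jacobi identity, and A and B belong to it.
  let L : Submodule ℝ (Matrix (Fin N) (Fin N) ℂ) :=
    { carrier := {X | X ∈ V ∧ ∀ Y ∈ V, ⁅X, Y⁆ ∈ V}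
      add_mem' := fun {X Y} hX hY => ⟨V.add_mem hX.1 hY.1, fun Z hZ => by
        rw [br_add_left]; exact V.add_mem (hX.2 Z hZ) (hY.2 Z hZ)⟩
      zero_mem' := ⟨V.zero_mem, fun Z _ => by simp [Ring.lie_def]⟩
      smul_mem' := fun c X hX => ⟨V.smul_mem c hX.1, fun Z hZ => by
        rw [br_smul_left]; exact V.smul_mem c (hX.2 Z hZ)⟩ }
  have hL : ∀ X ∈ L, ∀ Y ∈ L, ⁅X, Y⁆ ∈ L := fun X hX Y hY =>
    ⟨hX.2 Y hY.1, fun Z hZ => by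
      rw [br_br]
      exact V.sub_mem (hX.2 _ (hY.2 Z hZ)) (hY.2 _ (hX.2 Z hZ))⟩
  have hsm : ∀ (c : ℝ) (X : Matrix (Fin N) (Fin N) ℂ), (c : ℂ) • X = c • X := fun c X => by
    ext i j; simp
  let W : Submodule ℂ (Matrix (Fin N) (Fin N) ℂ) :=
    { carrier := {X | ∃ P ∈ L, ∃ Q ∈ L, X = P + Complex.I • Q}
      add_mem' := by
        rintro _ _ ⟨P, hP, Q, hQ, rfl⟩ ⟨P', hP', Q', hQ', rfl⟩
        exact ⟨P + P', L.add_mem hP hP', Q + Q', L.add_mem hQ hQ', by rw [smul_add]; abel⟩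
      zero_mem' := ⟨0, L.zero_mem, 0, L.zero_mem, by simp⟩
      smul_mem' := by
        rintro c _ ⟨P, hP, Q, hQ, rfl⟩
        refine ⟨c.re • P - c.im • Q, L.sub_mem (L.smul_mem _ hP) (L.smul_mem _ hQ),
          c.re • Q + c.im • P, L.add_mem (L.smul_mem _ hQ) (L.smul_mem _ hP), ?_⟩
        conv_lhs => rw [← Complex.re_add_im c]
        simp only [← hsm]
        ext i j
        simp only [Matrix.smul_apply, Matrix.add_apply, Matrix.sub_apply, smul_eq_mul]
        linear_combination (c.im * Q i j) * Complex.I_sq }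
  have hW : ∀ X ∈ W, ∀ Y ∈ W, ⁅X, Y⁆ ∈ W := by
    rintro _ ⟨P, hP, Q, hQ, rfl⟩ _ ⟨P', hP', Q', hQ', rfl⟩
    refine ⟨⁅P, P'⁆ - ⁅Q, Q'⁆, L.sub_mem (hL _ hP _ hP') (hL _ hQ _ hQ'),
      ⁅P, Q'⁆ + ⁅Q, P'⁆, L.add_mem (hL _ hP _ hQ') (hL _ hQ _ hP'), ?_⟩
    have hI : ∀ Z : Matrix (Fin N) (Fin N) ℂ, Complex.I • Complex.I • Z = -Z := fun Z => by
      rw [smul_smul, Complex.I_mul_I, neg_one_smul]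
    simp only [Ring.lie_def, add_mul, mul_add, smul_mul_assoc, mul_smul_comm, hI, smul_add,
      smul_sub]
    abel
  have hLW : ∀ X ∈ L, X ∈ W := fun X hX => ⟨X, hX, 0, L.zero_mem, by simp⟩
  intro X hX
  obtain ⟨P, hP, Q, hQ, hPQ⟩ := mem_of_trace_eq_zero hE hE' hB hconn hreg W hW
    (hLW _ ⟨hAV, hA⟩) (hLW _ ⟨hBV, hB'⟩) X hX.2
  have h1 := hX.1
  rw [hPQ, conjTranspose_add, conjTranspose_smul, hV P hP.1, hV Q hQ.1] at h1
  -- P is skew-Hermitian and iQ is Hermitian, so skewness of P + iQ kills iQ.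
  have h2 : Complex.I • Q = 0 := by
    ext i j
    have := congrFun (congrFun h1 i) j
    simp at this
    simp only [Matrix.smul_apply, smul_eq_mul, Matrix.zero_apply]
    linear_combination (1 / 2 : ℂ) * this
  rw [hPQ, h2, add_zero]
  exact hP.1

end

/-- Reduces condition (1) to condition (2). A root vanishing at D would take the same value as its
negative, which is a different root. -/
theorem IsRegularDiag.isRegularAlong {N : ℕ} {D : Matrix (Fin N) (Fin N) ℂ}
    (hD : IsRegularDiag D) (M : Matrix (Fin N) (Fin N) ℂ) : IsRegularAlong D M := by
  refine ⟨fun p hp h => ?_, fun p hp q hq hpq => hD _ _ _ _ hp.1.ne hq.1.ne hpq⟩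
  refine hD p.1 p.2 p.2 p.1 hp.1.ne hp.1.ne' (fun h => hp.1.ne (congrArg Prod.fst h)) ?_
  simp only [rootValue] at h ⊢
  linear_combination 2 * h

/-! ### The exponential of su(N) and a complement to su(N) -/

section

open Matrix NormedSpace
open scoped Matrix.Norms.L2Operator

theorem exp_unitary_conj_diagonal {n : Type*} [Fintype n] [DecidableEq n]
    (U : unitaryGroup n ℂ) (d : n → ℂ) :
    exp ((U : Matrix n n ℂ) * diagonal d * star (U : Matrix n n ℂ)) =
      U * diagonal (fun i => Complex.exp (d i)) * star (U : Matrix n n ℂ) := by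
  have h := Matrix.exp_units_conj (Unitary.toUnits U) (diagonal d)
  have h2 : exp d = fun i => Complex.exp (d i) := by
    ext i
    rw [Pi.coe_exp, Complex.exp_eq_exp_ℂ]
  rw [Matrix.exp_diagonal, h2] at h
  exact h

/-- Skew-Hermitian matrices are unitarily diagonalizable. -/
theorem exists_unitary_conj_diagonal_of_skew {n : Type*} [Fintype n] [DecidableEq n]
    {M : Matrix n n ℂ} (hM : Mᴴ = -M) :
    ∃ (U : unitaryGroup n ℂ) (θ : n → ℝ),
      M = U * diagonal (fun i => Complex.I * θ i) * star (U : Matrix n n ℂ) := by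
  have hK : ((-Complex.I) • M).IsHermitian := by
    rw [IsHermitian, conjTranspose_smul, hM]
    simp
  refine ⟨hK.eigenvectorUnitary, hK.eigenvalues, ?_⟩
  have h := hK.spectral_theorem
  rw [Unitary.conjStarAlgAut_apply] at h
  have h2 : diagonal (fun i => Complex.I * (hK.eigenvalues i : ℂ)) =
      Complex.I • diagonal (RCLike.ofReal ∘ hK.eigenvalues : n → ℂ) := by
    ext i j
    by_cases hij : i = j <;> simp [hij]
  rw [h2, mul_smul_comm, smul_mul_assoc, ← h, smul_smul]
  simp

theorem det_unitary_conj {n : Type*} [Fintype n] [DecidableEq n] (U : unitaryGroup n ℂ)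
    (X : Matrix n n ℂ) : (U * X * star (U : Matrix n n ℂ)).det = X.det := by
  rw [det_mul_right_comm, Unitary.mul_star_self_of_mem U.2, one_mul]

theorem trace_unitary_conj {n : Type*} [Fintype n] [DecidableEq n] (U : unitaryGroup n ℂ)
    (X : Matrix n n ℂ) : (U * X * star (U : Matrix n n ℂ)).trace = X.trace := by
  rw [trace_mul_cycle, Unitary.coe_star_mul_self, one_mul]

theorem exp_mem_unitaryGroup_of_skew {n : Type*} [Fintype n] [DecidableEq n]
    {M : Matrix n n ℂ} (hM : Mᴴ = -M) : exp M ∈ unitaryGroup n ℂ := by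
  rw [mem_unitaryGroup_iff, star_eq_conjTranspose, ← Matrix.exp_conjTranspose, hM,
    ← Matrix.exp_add_of_commute _ _ (Commute.refl M).neg_right, add_neg_cancel, exp_zero]

/-- The exponential maps `su N` into `SU(N)`. -/
theorem exp_mem_specialUnitaryGroup {N : ℕ} {M : Matrix (Fin N) (Fin N) ℂ} (hM : M ∈ su N) :
    exp M ∈ specialUnitaryGroup (Fin N) ℂ := by
  rw [mem_specialUnitaryGroup_iff]
  refine ⟨exp_mem_unitaryGroup_of_skew hM.1, ?_⟩
  obtain ⟨U, θ, h⟩ := exists_unitary_conj_diagonal_of_skew hM.1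
  have ht := hM.2
  rw [h, trace_unitary_conj, trace_diagonal] at ht
  rw [h, exp_unitary_conj_diagonal, det_unitary_conj, det_diagonal, ← Complex.exp_sum, ht,
    Complex.exp_zero]

/-- Every unitary matrix is the exponential of a skew-Hermitian matrix. -/
theorem exists_skew_exp_eq {n : Type*} [Fintype n] [DecidableEq n] {X : Matrix n n ℂ}
    (hX : X ∈ unitaryGroup n ℂ) : ∃ M : Matrix n n ℂ, Mᴴ = -M ∧ exp M = X := by
  have hn : IsStarNormal X := ⟨by
    rw [Commute, SemiconjBy, Unitary.star_mul_self_of_mem hX, Unitary.mul_star_self_of_mem hX]⟩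
  -- The spectrum is finite, so the jump of `Complex.arg` is harmless to the functional calculus.
  have hc : ∀ f : ℂ → ℂ, ContinuousOn f (spectrum ℂ X) := fun f =>
    (Matrix.finite_spectrum X).continuousOn f
  set g : ℂ → ℂ := fun z => Complex.I * (Complex.arg z : ℂ) with hg
  refine ⟨cfc g X, ?_, ?_⟩
  · rw [← star_eq_conjTranspose, ← cfc_star, ← cfc_neg]
    congr 1
    ext z
    simp [hg]
  · have hp : IsStarNormal (cfc g X) := cfc_predicate g X
    rw [← CFC.complex_exp_eq_normedSpace_exp hp, ← cfc_comp Complex.exp g X hn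
      (((Matrix.finite_spectrum X).image g).continuousOn _) (hc g)]
    conv_rhs => rw [← cfc_id ℂ X hn]
    refine cfc_congr fun z hz => ?_
    have hz1 : ‖z‖ = 1 := by
      simpa using Unitary.spectrum_subset_circle (⟨X, hX⟩ : unitary (Matrix n n ℂ)) hz
    have := Complex.norm_mul_exp_arg_mul_I z
    rw [hz1, Complex.ofReal_one, one_mul] at this
    simp only [Function.comp_apply, hg, id]
    rw [mul_comm, this]

/-- The exponential maps `su N` onto `SU(N)`. -/
theorem exists_su_exp_eq {N : ℕ} {X : Matrix (Fin N) (Fin N) ℂ}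
    (hX : X ∈ specialUnitaryGroup (Fin N) ℂ) : ∃ M ∈ su N, exp M = X := by
  rcases Nat.eq_zero_or_pos N with rfl | hN
  · exact ⟨0, ⟨by simp, by simp⟩, Subsingleton.elim _ _⟩
  rw [mem_specialUnitaryGroup_iff] at hX
  obtain ⟨M, hM, rfl⟩ := exists_skew_exp_eq hX.1
  obtain ⟨U, θ, h⟩ := exists_unitary_conj_diagonal_of_skew hM
  have hdet := hX.2
  rw [h, exp_unitary_conj_diagonal, det_unitary_conj, det_diagonal, ← Complex.exp_sum,
    Complex.exp_eq_one_iff] at hdet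
  obtain ⟨k, hk⟩ := hdet
  let i₀ : Fin N := ⟨0, hN⟩
  -- Determinant one makes the angles sum to 2πk. Subtracting 2πk from one of them gives trace zero
  -- without changing the exponential.
  set θ' : Fin N → ℝ := fun i => θ i - if i = i₀ then k * (2 * Real.pi) else 0 with hθ'
  refine ⟨U * diagonal (fun i => Complex.I * θ' i) * star (U : Matrix (Fin N) (Fin N) ℂ),
    ⟨?_, ?_⟩, ?_⟩
  · have hd : (diagonal fun i => Complex.I * (θ' i : ℂ))ᴴ =
        -diagonal fun i => Complex.I * (θ' i : ℂ) := by
      rw [diagonal_conjTranspose, diagonal_neg]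
      congr 1
      ext i
      simp
    rw [star_eq_conjTranspose, conjTranspose_mul, conjTranspose_mul, hd,
      conjTranspose_conjTranspose, mul_assoc, neg_mul, mul_neg]
  · rw [trace_unitary_conj, trace_diagonal]
    have : ∀ i, Complex.I * (θ' i : ℂ) =
        Complex.I * θ i - if i = i₀ then k * (2 * Real.pi * Complex.I) else 0 := by
      intro i
      by_cases hi : i = i₀ <;> simp [hθ', hi]
      ring
    simp_rw [this]
    rw [Finset.sum_sub_distrib, hk]
    simp
  · rw [h, exp_unitary_conj_diagonal, exp_unitary_conj_diagonal]
    congr 3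
    ext i
    by_cases hi : i = i₀
    · rw [Complex.exp_eq_exp_iff_exists_int]
      refine ⟨-k, ?_⟩
      simp [hθ', hi]
      ring
    · simp [hθ', hi]

/-- The projection of a matrix along `su N` onto the sum of the Hermitian matrices and the imaginary
scalar matrices. -/
noncomputable def normalPart {N : ℕ} :
    Matrix (Fin N) (Fin N) ℂ →L[ℝ] Matrix (Fin N) (Fin N) ℂ :=
  LinearMap.toContinuousLinearMap
    { toFun := fun Z => (2⁻¹ : ℝ) • (Z + Zᴴ) + (((N : ℝ)⁻¹ * Z.trace.im : ℝ) * Complex.I) • 1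
      map_add' := fun X Y => by
        rw [conjTranspose_add, trace_add, Complex.add_im, mul_add, Complex.ofReal_add, add_mul,
          add_smul]
        module
      map_smul' := fun c X => by
        rw [conjTranspose_smul, trace_smul, Complex.smul_im, RingHom.id_apply, smul_add, smul_add,
          smul_add, smul_add, star_trivial, smul_comm c, smul_comm c, ← smul_assoc c]
        congr 2
        simp
        ring }

theorem normalPart_apply {N : ℕ} (Z : Matrix (Fin N) (Fin N) ℂ) :
    normalPart Z = (2⁻¹ : ℝ) • (Z + Zᴴ) + (((N : ℝ)⁻¹ * Z.trace.im : ℝ) * Complex.I) • 1 := rfl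

theorem sub_normalPart_mem_su {N : ℕ} (hN : N ≠ 0) (Z : Matrix (Fin N) (Fin N) ℂ) :
    Z - normalPart Z ∈ su N := by
  have hN' : (N : ℂ) ≠ 0 := Nat.cast_ne_zero.2 hN
  refine ⟨?_, ?_⟩
  · ext i j
    rw [normalPart_apply]
    by_cases h : i = j
    · subst h
      simp
      ring
    · simp [h, Ne.symm h]
      ring
  · rw [normalPart_apply, trace_sub, trace_add, trace_smul, trace_add, trace_smul, trace_one,
      trace_conjTranspose, Fintype.card_fin]
    apply Complex.ext
    · simp
      ring
    · simp
      field_simp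
      ring

/-- The derivative of exp at 0 is the identity, so exp does not return to the value 1 at other
points near 0. -/
theorem eventually_exp_eq_one_imp {N : ℕ} :
    ∀ᶠ Z : Matrix (Fin N) (Fin N) ℂ in 𝓝 0, exp Z = 1 → Z = 0 := by
  have h := (hasStrictFDerivAt_exp_zero (𝕂 := ℝ) (𝔸 := Matrix (Fin N) (Fin N) ℂ)).hasFDerivAt
  have h2 := h.eventually_ne (c := 1) ⟨1, fun z w => by simp⟩
  rw [eventually_nhdsWithin_iff] at h2
  filter_upwards [h2] with Z hZ h1
  by_contra h3
  exact hZ h3 h1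

/-- Near `0`, the only exponential of a matrix in the range of `normalPart` that is special unitary
is the identity. -/
theorem eventually_normalPart_eq_zero {N : ℕ} (hN : N ≠ 0) :
    ∀ᶠ Z : Matrix (Fin N) (Fin N) ℂ in 𝓝 0,
      exp (normalPart Z) ∈ specialUnitaryGroup (Fin N) ℂ → normalPart Z = 0 := by
  have h1 : Filter.Tendsto (fun Z : Matrix (Fin N) (Fin N) ℂ => Z + Zᴴ) (𝓝 0) (𝓝 0) := by
    have : Continuous fun Z : Matrix (Fin N) (Fin N) ℂ => Z + Zᴴ := by fun_prop
    simpa using this.tendsto 0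
  -- Any bound below 2π would do: the determinant condition will put this number in 2πℤ.
  have h2 : ∀ᶠ Z : Matrix (Fin N) (Fin N) ℂ in 𝓝 0, |Z.trace.im| < 1 := by
    have : Continuous fun Z : Matrix (Fin N) (Fin N) ℂ => |Z.trace.im| := by
      unfold Matrix.trace
      fun_prop
    have h3 := this.tendsto 0
    simp only [trace_zero, Complex.zero_im, abs_zero] at h3
    exact h3.eventually (gt_mem_nhds one_pos)
  filter_upwards [h1.eventually eventually_exp_eq_one_imp, h2] with Z hZ htr hmem
  rw [mem_specialUnitaryGroup_iff] at hmem
  set c : ℝ := (N : ℝ)⁻¹ * Z.trace.im with hc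
  have hstar : (normalPart Z)ᴴ = (2⁻¹ : ℝ) • (Z + Zᴴ) - ((c : ℂ) * Complex.I) • 1 := by
    rw [normalPart_apply, conjTranspose_add, conjTranspose_smul, conjTranspose_smul,
      conjTranspose_add, conjTranspose_conjTranspose, conjTranspose_one, add_comm Zᴴ, sub_eq_add_neg,
      ← neg_smul]
    congr 2
    simp [hc]
  have hsum : normalPart Z + (normalPart Z)ᴴ = Z + Zᴴ := by
    rw [hstar, normalPart_apply, ← hc]
    module
  -- `normalPart Z` is Hermitian plus an imaginary scalar, so it commutes with its adjoint.
  -- Unitarity of its exponential then reads exp (Z + Zᴴ) = 1.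
  have hcomm : Commute (normalPart Z) (normalPart Z)ᴴ := by
    have : (normalPart Z)ᴴ = normalPart Z - ((2 * c : ℂ) * Complex.I) • 1 := by
      rw [hstar, normalPart_apply, ← hc]
      module
    rw [this]
    exact (Commute.refl _).sub_right ((Commute.one_right _).smul_right _)
  have hu := hmem.1
  rw [mem_unitaryGroup_iff, star_eq_conjTranspose, ← Matrix.exp_conjTranspose,
    ← Matrix.exp_add_of_commute _ _ hcomm, hsum] at hu
  have h0 := hZ hu
  have hP : normalPart Z = diagonal fun _ => (c : ℂ) * Complex.I := by
    rw [normalPart_apply, h0, smul_zero, zero_add, ← hc, smul_one_eq_diagonal]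
  have hd := hmem.2
  have hN' : (N : ℝ) ≠ 0 := Nat.cast_ne_zero.2 hN
  have h3 : exp (fun _ : Fin N => (c : ℂ) * Complex.I) =
      fun _ => Complex.exp ((c : ℂ) * Complex.I) := by
    ext i
    rw [Pi.coe_exp, Complex.exp_eq_exp_ℂ]
  rw [hP, Matrix.exp_diagonal, h3, det_diagonal, ← Complex.exp_sum, Complex.exp_eq_one_iff] at hd
  obtain ⟨k, hk⟩ := hd
  have hk2 : Z.trace.im = k * (2 * Real.pi) := by
    have h4 := congrArg Complex.im hk
    simp at h4
    rw [← h4, hc, mul_inv_cancel_left₀ hN']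
  have hk0 : k = 0 := by
    by_contra hne
    have h5 : (1 : ℝ) ≤ |(k : ℝ)| := by exact_mod_cast Int.one_le_abs hne
    rw [hk2, abs_mul, abs_of_pos Real.two_pi_pos] at htr
    nlinarith [Real.pi_gt_three]
  have hc0 : c = 0 := by
    rw [hc, hk2, hk0]
    simp
  rw [hP, hc0]
  simp

end

/-! ### Compactness of SU(N) and the semigroup of exponentials -/

section

open Matrix NormedSpace
open scoped Matrix.Norms.L2Operator

instance specialUnitaryGroup_isTopologicalGroup {n : Type*} [Fintype n] [DecidableEq n] :
    IsTopologicalGroup (specialUnitaryGroup n ℂ) where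
  continuous_inv := Continuous.subtype_mk (continuous_star.comp continuous_subtype_val) _

instance specialUnitaryGroup_compactSpace {n : Type*} [Fintype n] [DecidableEq n] :
    CompactSpace (specialUnitaryGroup n ℂ) := by
  have hclosed : IsClosed (specialUnitaryGroup n ℂ : Set (Matrix n n ℂ)) := by
    have h : (specialUnitaryGroup n ℂ : Set (Matrix n n ℂ)) =
        (fun X : Matrix n n ℂ => (X * star X, X.det)) ⁻¹' {(1, 1)} := by
      ext X
      simp [mem_specialUnitaryGroup_iff, mem_unitaryGroup_iff]
    rw [h]
    refine isClosed_singleton.preimage ?_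
    fun_prop
  have hbdd : Bornology.IsBounded (specialUnitaryGroup n ℂ : Set (Matrix n n ℂ)) := by
    refine (Metric.isBounded_closedBall (x := (0 : Matrix n n ℂ)) (r := 1)).subset fun X hX => ?_
    rw [mem_closedBall_zero_iff]
    rcases subsingleton_or_nontrivial (Matrix n n ℂ) with h | h
    · rw [Subsingleton.elim X 0, norm_zero]
      exact zero_le_one
    · exact (CStarRing.norm_of_mem_unitary (mem_specialUnitaryGroup_iff.1 hX).1).le
  have : ProperSpace (Matrix n n ℂ) := FiniteDimensional.proper ℝ _
  exact isCompact_iff_compactSpace.1 (Metric.isCompact_of_isClosed_isBounded hclosed hbdd)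

variable {N : ℕ}

/-- The subsemigroup of `SU(N)` generated by the exponentials `exp (t M)`, `t ≥ 0`, `M ∈ 𝓜`. -/
noncomputable def expSemigroup (𝓜 : Set (Matrix (Fin N) (Fin N) ℂ)) :
    Submonoid (specialUnitaryGroup (Fin N) ℂ) :=
  Submonoid.closure {g | ∃ M ∈ 𝓜, ∃ t : ℝ, 0 ≤ t ∧ (g : Matrix (Fin N) (Fin N) ℂ) = exp (t • M)}

variable {𝓜 : Set (Matrix (Fin N) (Fin N) ℂ)}

theorem smul_mem_su {M : Matrix (Fin N) (Fin N) ℂ} (hM : M ∈ su N) (t : ℝ) : t • M ∈ su N :=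
  ⟨by rw [conjTranspose_smul, hM.1, star_trivial, smul_neg], by rw [trace_smul, hM.2, smul_zero]⟩

theorem exists_mem_expSemigroup (h𝓜 : 𝓜 ⊆ su N) {M : Matrix (Fin N) (Fin N) ℂ} (hM : M ∈ 𝓜)
    {t : ℝ} (ht : 0 ≤ t) :
    ∃ g ∈ expSemigroup 𝓜, (g : Matrix (Fin N) (Fin N) ℂ) = exp (t • M) :=
  ⟨⟨_, exp_mem_specialUnitaryGroup (smul_mem_su (h𝓜 hM) t)⟩,
    Submonoid.subset_closure ⟨M, hM, t, ht, rfl⟩, rfl⟩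

theorem specialUnitary_mul_star (s : specialUnitaryGroup (Fin N) ℂ) :
    (s : Matrix (Fin N) (Fin N) ℂ) * star (s : Matrix (Fin N) (Fin N) ℂ) = 1 :=
  mem_unitaryGroup_iff.1 (mem_specialUnitaryGroup_iff.1 s.2).1

theorem specialUnitary_star_mul (s : specialUnitaryGroup (Fin N) ℂ) :
    star (s : Matrix (Fin N) (Fin N) ℂ) * (s : Matrix (Fin N) (Fin N) ℂ) = 1 :=
  mem_unitaryGroup_iff'.1 (mem_specialUnitaryGroup_iff.1 s.2).1

/-- The real span of the conjugates of the elements of `𝓜` under the semigroup they generate. -/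
noncomputable def conjSpan (𝓜 : Set (Matrix (Fin N) (Fin N) ℂ)) : Submodule ℝ (Matrix (Fin N) (Fin N) ℂ) :=
  Submodule.span ℝ {Z | ∃ s ∈ expSemigroup 𝓜, ∃ M ∈ 𝓜,
    Z = (s : Matrix (Fin N) (Fin N) ℂ) * M * star (s : Matrix (Fin N) (Fin N) ℂ)}

theorem subset_conjSpan : 𝓜 ⊆ conjSpan 𝓜 := fun M hM =>
  Submodule.subset_span ⟨1, one_mem _, M, hM, by simp⟩

theorem conjTranspose_of_mem_conjSpan (h𝓜 : 𝓜 ⊆ su N) {X : Matrix (Fin N) (Fin N) ℂ}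
    (hX : X ∈ conjSpan 𝓜) : Xᴴ = -X := by
  induction hX using Submodule.span_induction with
  | mem X hX =>
    obtain ⟨s, -, M, hM, rfl⟩ := hX
    rw [star_eq_conjTranspose, conjTranspose_mul, conjTranspose_mul, (h𝓜 hM).1,
      conjTranspose_conjTranspose, mul_assoc, neg_mul, mul_neg]
  | zero => simp
  | add X Y _ _ hX hY => rw [conjTranspose_add, hX, hY, neg_add]
  | smul c X _ hX => rw [conjTranspose_smul, hX, star_trivial, smul_neg]

theorem conj_mem_conjSpan {s : specialUnitaryGroup (Fin N) ℂ} (hs : s ∈ expSemigroup 𝓜)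
    {X : Matrix (Fin N) (Fin N) ℂ} (hX : X ∈ conjSpan 𝓜) :
    (s : Matrix (Fin N) (Fin N) ℂ) * X * star (s : Matrix (Fin N) (Fin N) ℂ) ∈ conjSpan 𝓜 := by
  induction hX using Submodule.span_induction with
  | mem X hX =>
    obtain ⟨r, hr, M, hM, rfl⟩ := hX
    refine Submodule.subset_span ⟨s * r, mul_mem hs hr, M, hM, ?_⟩
    simp only [Submonoid.coe_mul, star_mul, mul_assoc]
  | zero => simp
  | add X Y _ _ hX hY =>
    rw [mul_add, add_mul]
    exact add_mem hX hY
  | smul c X _ hX =>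
    rw [mul_smul_comm, smul_mul_assoc]
    exact Submodule.smul_mem _ _ hX

/-- Conjugation by exp(tM), t ≥ 0, preserves the span. Its right derivative at 0 is the bracket, and
a finite-dimensional subspace is closed, so one-sided times suffice. -/
theorem lie_mem_conjSpan (h𝓜 : 𝓜 ⊆ su N) {M X : Matrix (Fin N) (Fin N) ℂ} (hM : M ∈ 𝓜)
    (hX : X ∈ conjSpan 𝓜) : ⁅M, X⁆ ∈ conjSpan 𝓜 := by
  set f : ℝ → Matrix (Fin N) (Fin N) ℂ := fun t => exp (t • M) * X * exp (t • -M) with hf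
  have hd : HasDerivAt f ⁅M, X⁆ 0 := by
    have h1 := ((hasDerivAt_exp_smul_const M (0 : ℝ)).mul_const X).mul
      (hasDerivAt_exp_smul_const (-M) (0 : ℝ))
    refine h1.congr_deriv ?_
    simp [Ring.lie_def, sub_eq_add_neg]
  have hmem : ∀ t : ℝ, 0 ≤ t → f t ∈ conjSpan 𝓜 := by
    intro t ht
    obtain ⟨g, hg, hgt⟩ := exists_mem_expSemigroup h𝓜 hM ht
    have hstar : star (g : Matrix (Fin N) (Fin N) ℂ) = exp (t • -M) := by
      rw [hgt, star_eq_conjTranspose, ← Matrix.exp_conjTranspose, conjTranspose_smul, star_trivial,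
        (h𝓜 hM).1]
    have := conj_mem_conjSpan hg hX
    rwa [hstar, hgt] at this
  have hclosed : IsClosed (conjSpan 𝓜 : Set (Matrix (Fin N) (Fin N) ℂ)) :=
    Submodule.closed_of_finiteDimensional _
  have ht := (hasDerivWithinAt_iff_tendsto_slope' (s := Set.Ioi (0 : ℝ)) Set.self_notMem_Ioi).1
    hd.hasDerivWithinAt
  refine hclosed.mem_of_tendsto ht ?_
  filter_upwards [self_mem_nhdsWithin] with t ht'
  rw [slope_def_module]
  exact Submodule.smul_mem _ _ (sub_mem (hmem t (le_of_lt ht')) (hmem 0 le_rfl))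

/-! ### Maps of greatest rank and interior points of the semigroup -/

/-- `r` is the rank at a point of a strictly differentiable map from a Banach space to the
semigroup generated by `𝓜`. -/
def IsAttainedRank (𝓜 : Set (Matrix (Fin N) (Fin N) ℂ)) (r : ℕ) : Prop :=
  ∃ (E : Type) (_ : NormedAddCommGroup E) (_ : NormedSpace ℝ E) (_ : CompleteSpace E)
    (F : E → Matrix (Fin N) (Fin N) ℂ) (F' : E →L[ℝ] Matrix (Fin N) (Fin N) ℂ),
    HasStrictFDerivAt F F' 0 ∧
    (∀ᶠ e in 𝓝 (0 : E), ∃ s ∈ expSemigroup 𝓜, (s : Matrix (Fin N) (Fin N) ℂ) = F e) ∧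
    Module.finrank ℝ (LinearMap.range F'.toLinearMap) = r

theorem exists_greatest_attainedRank (𝓜 : Set (Matrix (Fin N) (Fin N) ℂ)) :
    ∃ r, IsAttainedRank 𝓜 r ∧ ∀ r', IsAttainedRank 𝓜 r' → r' ≤ r := by
  classical
  have h0 : IsAttainedRank 𝓜 0 :=
    ⟨ℝ, inferInstance, inferInstance, inferInstance, fun _ => 1, 0, hasStrictFDerivAt_const _ _,
      Filter.Eventually.of_forall fun _ => ⟨1, one_mem _, rfl⟩, by simp⟩
  set b := Module.finrank ℝ (Matrix (Fin N) (Fin N) ℂ)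
  refine ⟨Nat.findGreatest (IsAttainedRank 𝓜) b, Nat.findGreatest_spec (Nat.zero_le b) h0,
    fun r' hr' => Nat.le_findGreatest ?_ hr'⟩
  obtain ⟨E, _, _, _, F, F', -, -, rfl⟩ := hr'
  exact Submodule.finrank_le _

/-- At a map of greatest rank, the range of the derivative contains all translates of the
conjugates of the generators. -/
theorem mul_conj_mem_range (h𝓜 : 𝓜 ⊆ su N) {E : Type} [NormedAddCommGroup E] [NormedSpace ℝ E]
    [CompleteSpace E] {F : E → Matrix (Fin N) (Fin N) ℂ}
    {F' : E →L[ℝ] Matrix (Fin N) (Fin N) ℂ} (hF : HasStrictFDerivAt F F' 0)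
    (hFS : ∀ᶠ e in 𝓝 (0 : E), ∃ s ∈ expSemigroup 𝓜, (s : Matrix (Fin N) (Fin N) ℂ) = F e)
    (hmax : ∀ r, IsAttainedRank 𝓜 r →
      r ≤ Module.finrank ℝ (LinearMap.range F'.toLinearMap))
    {X : Matrix (Fin N) (Fin N) ℂ} (hX : X ∈ conjSpan 𝓜) :
    F 0 * X ∈ LinearMap.range F'.toLinearMap := by
  suffices h : conjSpan 𝓜 ≤
      (LinearMap.range F'.toLinearMap).comap (LinearMap.mulLeft ℝ (F 0)) from h hX
  refine Submodule.span_le.2 ?_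
  rintro _ ⟨s, hs, M, hM, rfl⟩
  change F 0 * ((s : Matrix (Fin N) (Fin N) ℂ) * M * star (s : Matrix (Fin N) (Fin N) ℂ)) ∈
    LinearMap.range F'.toLinearMap
  -- The map F is extended to (e, τ) ↦ F(e) s exp((τ + 1)M). Starting at time 1 leaves room for τ of
  -- both signs without leaving the semigroup.
  obtain ⟨g, hg, hgM⟩ := exists_mem_expSemigroup h𝓜 hM zero_le_one
  rw [one_smul] at hgM
  have h1 : HasStrictFDerivAt (fun p : E × ℝ => F p.1 * (s : Matrix (Fin N) (Fin N) ℂ))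
      _ (0 : E × ℝ) := (hF.comp (0 : E × ℝ) hasStrictFDerivAt_fst).mul_const' _
  have h2 : HasStrictFDerivAt (fun p : E × ℝ => exp ((p.2 + 1) • M)) _ (0 : E × ℝ) :=
    HasStrictFDerivAt.comp (g := fun t : ℝ => exp (t • M)) (0 : E × ℝ)
      (hasStrictFDerivAt_exp_smul_const' ℝ M _)
      (hasStrictFDerivAt_snd.add_const 1)
  have h3 := h1.mul' h2
  set G' := _
  change HasStrictFDerivAt _ G' _ at h3
  have hG' : ∀ p : E × ℝ, G' p = F' p.1 * (s * g : Matrix (Fin N) (Fin N) ℂ) +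
      p.2 • (F 0 * (s * M) * g) := by
    intro p
    simp [G', hgM, mul_assoc, add_comm]
  have hGS : ∀ᶠ p in 𝓝 (0 : E × ℝ), ∃ s' ∈ expSemigroup 𝓜,
      (s' : Matrix (Fin N) (Fin N) ℂ) = F p.1 * s * exp ((p.2 + 1) • M) := by
    have ha : ∀ᶠ p in 𝓝 (0 : E × ℝ), ∃ s' ∈ expSemigroup 𝓜,
        (s' : Matrix (Fin N) (Fin N) ℂ) = F p.1 :=
      (continuous_fst.tendsto (0 : E × ℝ)).eventually hFS
    have hb : ∀ᶠ p in 𝓝 (0 : E × ℝ), (-1 : ℝ) < p.2 :=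
      (continuous_snd.tendsto (0 : E × ℝ)).eventually (lt_mem_nhds (by simp))
    filter_upwards [ha, hb] with p ⟨r, hr, hrF⟩ hp
    obtain ⟨k, hk, hkM⟩ := exists_mem_expSemigroup h𝓜 hM (t := p.2 + 1) (by linarith)
    exact ⟨r * s * k, mul_mem (mul_mem hr hs) hk, by simp [hrF, hkM]⟩
  have hrank := hmax _ ⟨E × ℝ, inferInstance, inferInstance, inferInstance, _, G', h3, hGS, rfl⟩
  set T : Matrix (Fin N) (Fin N) ℂ →ₗ[ℝ] Matrix (Fin N) (Fin N) ℂ :=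
    LinearMap.mulRight ℝ (s * g : Matrix (Fin N) (Fin N) ℂ) with hT
  have hsg : (s * g : Matrix (Fin N) (Fin N) ℂ) * star (s * g : Matrix (Fin N) (Fin N) ℂ) = 1 :=
    specialUnitary_mul_star (s * g)
  have hTinj : Function.Injective T := by
    intro X Y hXY
    have := congrArg (· * star (s * g : Matrix (Fin N) (Fin N) ℂ)) hXY
    simpa only [hT, LinearMap.mulRight_apply, mul_assoc X, mul_assoc Y, hsg, mul_one] using this
  have hle : (LinearMap.range F'.toLinearMap).map T ≤ LinearMap.range G'.toLinearMap := by
    rintro _ ⟨_, ⟨e, rfl⟩, rfl⟩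
    exact ⟨(e, 0), by simp [hG', hT, mul_assoc]⟩
  -- Right translation by sg preserves rank, so by maximality the τ-direction adds nothing new to
  -- the range.
  have heq := Submodule.eq_of_le_of_finrank_le hle (by
    rw [← (Submodule.equivMapOfInjective T hTinj _).finrank_eq]
    exact hrank)
  have hmem : F 0 * (s * M) * g ∈ LinearMap.range G'.toLinearMap := ⟨(0, 1), by simp [hG']⟩
  rw [← heq] at hmem
  obtain ⟨Y, hY, hYe⟩ := hmem
  have : F 0 * ((s : Matrix (Fin N) (Fin N) ℂ) * M * star (s : Matrix (Fin N) (Fin N) ℂ)) = Y := by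
    have h4 := congrArg (· * star (s * g : Matrix (Fin N) (Fin N) ℂ)) hYe
    simp only [hT, LinearMap.mulRight_apply, mul_assoc Y, hsg, mul_one] at h4
    rw [h4, star_mul, mul_assoc _ (g : Matrix (Fin N) (Fin N) ℂ),
      ← mul_assoc (g : Matrix (Fin N) (Fin N) ℂ), specialUnitary_mul_star]
    simp only [one_mul, mul_assoc]
  rw [this]
  exact hY

/-- If the conjugates of the generators span `su N`, the semigroup is a neighbourhood of one of its
elements. -/
theorem exists_expSemigroup_mem_nhds (hN : N ≠ 0) (h𝓜 : 𝓜 ⊆ su N)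
    (hspan : su N ⊆ conjSpan 𝓜) :
    ∃ s ∈ expSemigroup 𝓜, (expSemigroup 𝓜 : Set (specialUnitaryGroup (Fin N) ℂ)) ∈ 𝓝 s := by
  obtain ⟨_, ⟨E, _, _, _, F, F', hF, hFS, rfl⟩, hmax⟩ := exists_greatest_attainedRank 𝓜
  obtain ⟨s₀, hs₀, hs₀F⟩ := hFS.self_of_nhds
  refine ⟨s₀, hs₀, ?_⟩
  have h1 : HasStrictFDerivAt (fun p : E × Matrix (Fin N) (Fin N) ℂ => F p.1) _ 0 :=
    hF.comp (0 : E × Matrix (Fin N) (Fin N) ℂ) hasStrictFDerivAt_fst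
  have h2 : HasStrictFDerivAt (fun p : E × Matrix (Fin N) (Fin N) ℂ => exp (normalPart p.2))
      ((normalPart (N := N)).comp (ContinuousLinearMap.snd ℝ E (Matrix (Fin N) (Fin N) ℂ))) 0 := by
    have h3 : HasStrictFDerivAt (fun p : E × Matrix (Fin N) (Fin N) ℂ => normalPart p.2)
        ((normalPart (N := N)).comp (ContinuousLinearMap.snd ℝ E (Matrix (Fin N) (Fin N) ℂ))) 0 :=
      (normalPart (N := N)).hasStrictFDerivAt.comp
        (0 : E × Matrix (Fin N) (Fin N) ℂ) hasStrictFDerivAt_snd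
    have h4 : HasStrictFDerivAt exp (1 : Matrix (Fin N) (Fin N) ℂ →L[ℝ] Matrix (Fin N) (Fin N) ℂ)
        (normalPart (0 : E × Matrix (Fin N) (Fin N) ℂ).2) := by
      simpa using hasStrictFDerivAt_exp_zero (𝕂 := ℝ) (𝔸 := Matrix (Fin N) (Fin N) ℂ)
    have h6 := HasStrictFDerivAt.comp (f := fun p : E × Matrix (Fin N) (Fin N) ℂ => normalPart p.2)
      (f' := (normalPart (N := N)).comp
        (ContinuousLinearMap.snd ℝ E (Matrix (Fin N) (Fin N) ℂ))) 0 h4 h3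
    exact h6
  -- The values of F near 0 lie in SU(N). The factor exp(`normalPart` Z) supplies the transverse
  -- directions, so that the product is a submersion onto all matrices and the open mapping theorem
  -- applies.
  have h5 := h1.mul' h2
  have hsurj := h5.map_nhds_eq_of_surj (by
    rw [LinearMap.range_eq_top]
    intro Y
    obtain ⟨e, he⟩ := mul_conj_mem_range h𝓜 hF hFS hmax
      (hspan (sub_normalPart_mem_su hN (star (s₀ : Matrix (Fin N) (Fin N) ℂ) * Y)))
    refine ⟨(e, star (s₀ : Matrix (Fin N) (Fin N) ℂ) * Y), ?_⟩
    have he' : F' e = _ := he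
    simp [he', mul_sub, ← hs₀F, ← mul_assoc, specialUnitary_mul_star])
  -- If the product is special unitary, so is its second factor, which is therefore 1; the product
  -- is then a value of F.
  have hev : ∀ᶠ p in 𝓝 (0 : E × Matrix (Fin N) (Fin N) ℂ),
      F p.1 * exp (normalPart p.2) ∈ specialUnitaryGroup (Fin N) ℂ →
        ∃ s ∈ expSemigroup 𝓜, (s : Matrix (Fin N) (Fin N) ℂ) = F p.1 * exp (normalPart p.2) := by
    have ha := (continuous_fst.tendsto (0 : E × Matrix (Fin N) (Fin N) ℂ)).eventually hFS
    have hb := (continuous_snd.tendsto (0 : E × Matrix (Fin N) (Fin N) ℂ)).eventually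
      (eventually_normalPart_eq_zero hN)
    filter_upwards [ha, hb] with p ⟨r, hr, hrF⟩ hp hmem
    have h0 : normalPart p.2 = 0 := by
      apply hp
      have h6 := mul_mem (r⁻¹).2 hmem
      have h7 : ((r⁻¹ : specialUnitaryGroup (Fin N) ℂ) : Matrix (Fin N) (Fin N) ℂ) =
        star (r : Matrix (Fin N) (Fin N) ℂ) := rfl
      rwa [h7, ← hrF, ← mul_assoc, specialUnitary_star_mul, one_mul] at h6
    exact ⟨r, hr, by rw [h0, exp_zero, mul_one, hrF]⟩
  have hnear : ∀ᶠ Y in 𝓝 (s₀ : Matrix (Fin N) (Fin N) ℂ), Y ∈ specialUnitaryGroup (Fin N) ℂ →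
      ∃ s ∈ expSemigroup 𝓜, (s : Matrix (Fin N) (Fin N) ℂ) = Y := by
    have h8 : (s₀ : Matrix (Fin N) (Fin N) ℂ) =
        ((fun p : E × Matrix (Fin N) (Fin N) ℂ => F p.1) *
          fun p : E × Matrix (Fin N) (Fin N) ℂ => exp (normalPart p.2)) 0 := by
      simp [hs₀F]
    rw [h8, ← hsurj, Filter.eventually_map]
    exact hev
  filter_upwards [continuous_subtype_val.continuousAt.eventually hnear] with Y hY
  obtain ⟨s, hs, hsY⟩ := hY Y.2
  rw [← Subtype.ext hsY]
  exact hs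

/-! ### From an interior point to the whole group -/

/-- A subsemigroup of a compact group that is a neighbourhood of one of its elements is a
neighbourhood of the identity. -/
theorem submonoid_mem_nhds_one_of_compact {G : Type*} [Group G] [TopologicalSpace G]
    [IsTopologicalGroup G] [CompactSpace G] (S : Submonoid G) {s : G} (hs : s ∈ S)
    (hnhds : (S : Set G) ∈ 𝓝 s) : (S : Set G) ∈ 𝓝 1 := by
  have hcl : s⁻¹ ∈ closure (S : Set G) := by
    have := closure_submonoidClosure_eq_closure_subgroupClosure (S : Set G)
    rw [Submonoid.closure_eq] at this
    rw [this]
    exact subset_closure (inv_mem (Subgroup.subset_closure hs))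
  have hinv : {x : G | (S : Set G) ∈ 𝓝 x⁻¹} ∈ 𝓝 s⁻¹ := by
    have h := (continuous_inv (G := G)).tendsto s⁻¹
    rw [inv_inv] at h
    exact h.eventually (eventually_mem_nhds_iff.2 hnhds)
  -- This x in S is so close to s⁻¹ that S is a neighbourhood of x⁻¹; then Sx, contained in S, is a
  -- neighbourhood of 1.
  obtain ⟨x, hx, hxS⟩ := mem_closure_iff_nhds.1 hcl _ hinv
  have h1 : Filter.Tendsto (fun y : G => y * x⁻¹) (𝓝 1) (𝓝 x⁻¹) := by
    have : Continuous fun y : G => y * x⁻¹ := by fun_prop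
    simpa using this.tendsto 1
  filter_upwards [h1.eventually_mem hx] with y hy
  simpa using S.mul_mem hy hxS

/-- A subsemigroup of `SU(N)` that is a neighbourhood of the identity is all of `SU(N)`. -/
theorem eq_top_of_mem_nhds_one (S : Submonoid (specialUnitaryGroup (Fin N) ℂ))
    (hS : (S : Set (specialUnitaryGroup (Fin N) ℂ)) ∈ 𝓝 1) : S = ⊤ := by
  refine eq_top_iff.2 fun X _ => ?_
  obtain ⟨M, hM, hMX⟩ := exists_su_exp_eq X.2
  set γ : ℝ → specialUnitaryGroup (Fin N) ℂ := fun t =>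
    ⟨exp (t • M), exp_mem_specialUnitaryGroup (smul_mem_su hM t)⟩ with hγ
  have hγc : Continuous γ :=
    Continuous.subtype_mk (continuous_iff_continuousAt.2 fun t =>
      (hasDerivAt_exp_smul_const M t).continuousAt) _
  have h0 : γ 0 = 1 := Subtype.ext (by simp [hγ])
  have hlim : Filter.Tendsto (fun n : ℕ => γ (1 / ((n : ℝ) + 1))) Filter.atTop (𝓝 1) := by
    rw [← h0]
    exact (hγc.tendsto 0).comp tendsto_one_div_add_atTop_nhds_zero_nat
  obtain ⟨n, hn⟩ := (hlim.eventually_mem hS).exists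
  have hpow : γ (1 / ((n : ℝ) + 1)) ^ (n + 1) = X := by
    apply Subtype.ext
    rw [SubmonoidClass.coe_pow, ← hMX]
    change exp _ ^ (n + 1) = exp M
    rw [← Matrix.exp_nsmul, ← Nat.cast_smul_eq_nsmul ℝ, smul_smul]
    congr 1
    have : (n : ℝ) + 1 ≠ 0 := by positivity
    rw [Nat.cast_add, Nat.cast_one, mul_one_div_cancel this, one_smul]
  rw [← hpow]
  exact S.pow_mem hn _

/-- If every real space of skew-Hermitian matrices that contains `𝓜` and is invariant under the
brackets with `𝓜` contains `su N`, then the semigroup generated by the exponentials `exp (t M)` with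
`t ≥ 0` is `SU(N)`. -/
theorem expSemigroup_eq_top (hN : N ≠ 0) (h𝓜 : 𝓜 ⊆ su N)
    (hgen : ∀ V : Submodule ℝ (Matrix (Fin N) (Fin N) ℂ), (∀ X ∈ V, Xᴴ = -X) → 𝓜 ⊆ V →
      (∀ M ∈ 𝓜, ∀ X ∈ V, ⁅M, X⁆ ∈ V) → su N ⊆ V) : expSemigroup 𝓜 = ⊤ := by
  obtain ⟨s, hs, hnhds⟩ := exists_expSemigroup_mem_nhds hN h𝓜
    (hgen _ (fun X hX => conjTranspose_of_mem_conjSpan h𝓜 hX) subset_conjSpan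
      fun M hM X hX => lie_mem_conjSpan h𝓜 hM hX)
  exact eq_top_of_mem_nhds_one _ (submonoid_mem_nhds_one_of_compact _ hs hnhds)

end

/-! ### Trajectories and controllability -/

section

open Matrix NormedSpace
open scoped Matrix.Norms.L2Operator

variable {N : ℕ}

theorem one_mem_reachableSet (A B : Matrix (Fin N) (Fin N) ℂ) : 1 ∈ reachableSet A B :=
  ⟨0, le_rfl, fun _ => 0, fun _ => 1, ⟨rfl, continuousOn_const, ∅, fun s hs _ => by
    simp at hs⟩, rfl⟩

theorem hasDerivAt_exp_sub_smul_mul_apply (M Y : Matrix (Fin N) (Fin N) ℂ) (T s : ℝ) (i j : Fin N) :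
    HasDerivAt (fun r : ℝ => (exp ((r - T) • M) * Y) i j) ((M * (exp ((s - T) • M) * Y)) i j) s := by
  have h1 := (hasDerivAt_exp_smul_const' M (s - T)).comp_sub_const s T
  have h2 := h1.mul_const Y
  rw [mul_assoc] at h2
  exact ((Matrix.entryLinearMap ℝ ℂ i j).toContinuousLinearMap.hasFDerivAt).comp_hasDerivAt s h2

/-- A trajectory can be continued with a constant input. -/
theorem exp_mul_mem_reachableSet {A B : Matrix (Fin N) (Fin N) ℂ}
    {Y g : specialUnitaryGroup (Fin N) ℂ} (hY : Y ∈ reachableSet A B) (v : ℝ)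
    (hM : A + v • B ∈ su N) {t : ℝ} (ht : 0 ≤ t)
    (hg : (g : Matrix (Fin N) (Fin N) ℂ) = exp (t • (A + v • B))) :
    g * Y ∈ reachableSet A B := by
  obtain ⟨T, hT, u, X, ⟨hX0, hXc, F, hF⟩, hXT⟩ := hY
  set M := A + v • B with hMdef
  set γ : ℝ → specialUnitaryGroup (Fin N) ℂ := fun s =>
    ⟨exp ((s - T) • M), exp_mem_specialUnitaryGroup (smul_mem_su hM (s - T))⟩ * Y with hγ
  have hγapp : ∀ s, (γ s : Matrix (Fin N) (Fin N) ℂ) = exp ((s - T) • M) * Y := fun s => rfl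
  have hγT : γ T = X T := by
    rw [hXT]
    exact Subtype.ext (by simp [hγapp])
  have hγc : Continuous γ := by
    refine Continuous.mul (Continuous.subtype_mk (continuous_iff_continuousAt.2 fun s => ?_) _)
      continuous_const
    exact ((hasDerivAt_exp_smul_const M (s - T)).comp_sub_const s T).continuousAt
  set X' : ℝ → specialUnitaryGroup (Fin N) ℂ := fun s => if s ≤ T then X s else γ s with hX'
  have hle : ∀ s, s ≤ T → X' s = X s := fun s hs => if_pos hs
  have hge : ∀ s, T ≤ s → X' s = γ s := by
    intro s hs
    rcases hs.eq_or_lt with rfl | hs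
    · rw [hle _ le_rfl, hγT]
    · exact if_neg (not_le.2 hs)
  -- The switching time T joins the exceptional set, since the input may jump there.
  refine ⟨T + t, add_nonneg hT ht, fun s => if s ≤ T then u s else v, X',
    ⟨?_, ?_, insert T F, ?_⟩, ?_⟩
  · rw [hle 0 hT, hX0]
  · rw [← Set.Icc_union_Icc_eq_Icc hT (le_add_of_nonneg_right ht)]
    refine ContinuousOn.union_of_isClosed (hXc.congr fun s hs => hle s hs.2)
      (hγc.continuousOn.congr fun s hs => hge s hs.1) isClosed_Icc isClosed_Icc
  · intro s hs hsF
    rw [Finset.mem_insert, not_or] at hsF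
    rcases lt_or_gt_of_ne hsF.1 with hlt | hgt
    · obtain ⟨hu, hd⟩ := hF s ⟨hs.1, hlt⟩ hsF.2
      have hev : ∀ᶠ r in 𝓝 s, r ≤ T := (gt_mem_nhds hlt).mono fun r hr => le_of_lt hr
      refine ⟨?_, fun i j => ?_⟩
      · filter_upwards [hu, hev] with r hr hrT
        rw [if_pos hrT, if_pos hlt.le, hr]
      · beta_reduce
        rw [if_pos hlt.le, hle s hlt.le]
        refine (hd i j).congr_of_eventuallyEq ?_
        filter_upwards [hev] with r hr
        rw [hle r hr]
    · have hev : ∀ᶠ r in 𝓝 s, T < r := lt_mem_nhds hgt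
      refine ⟨?_, fun i j => ?_⟩
      · filter_upwards [hev] with r hr
        rw [if_neg (not_le.2 hr), if_neg (not_le.2 hgt)]
      · beta_reduce
        rw [if_neg (not_le.2 hgt), hge s hgt.le, hγapp]
        refine (hasDerivAt_exp_sub_smul_mul_apply M Y T s i j).congr_of_eventuallyEq ?_
        filter_upwards [hev] with r hr
        rw [hge r hr.le, hγapp]
  · rw [hge _ (le_add_of_nonneg_right ht)]
    apply Subtype.ext
    rw [hγapp, add_sub_cancel_left, ← hg]
    rfl

/-- Later inputs multiply on the left, hence the induction that peels off the leftmost exponential.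
-/
theorem expSemigroup_subset_reachableSet {A B : Matrix (Fin N) (Fin N) ℂ}
    (hM : {M | ∃ v : ℝ, M = A + v • B} ⊆ su N) :
    (expSemigroup {M | ∃ v : ℝ, M = A + v • B} : Set (specialUnitaryGroup (Fin N) ℂ)) ⊆
      reachableSet A B := by
  intro g hg
  induction hg using Submonoid.closure_induction_left with
  | one => exact one_mem_reachableSet A B
  | mul_left x hx y _ hy =>
    obtain ⟨_, ⟨v, rfl⟩, t, ht, hx⟩ := hx
    exact exp_mul_mem_reachableSet hy v (hM ⟨v, rfl⟩) ht hx

theorem drift_mem_su {E : Fin N → ℝ} (hE : ∑ k, E k = 0) : drift E ∈ su N := by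
  refine ⟨?_, ?_⟩
  · rw [drift_eq_diagonal, diagonal_conjTranspose, diagonal_neg]
    congr 1
    ext i
    simp
  · rw [drift_eq_diagonal, trace_diagonal, ← Finset.mul_sum, ← Complex.ofReal_sum, hE]
    simp

theorem isControllable_of_isRegularAlong {E : Fin N → ℝ} (hE0 : ∑ k, E k = 0) (hE : Monotone E)
    (hE' : ∀ i j, i ≠ j → E i ≠ E j) {B : Matrix (Fin N) (Fin N) ℂ} (hB : B ∈ su N)
    (hconn : (matrixGraph B).Connected)
    (hreg : IsRegularAlong (diagPart B) ⁅drift E, B⁆) : IsControllable (drift E) B := by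
  have hA := drift_mem_su hE0
  have hM : {M | ∃ v : ℝ, M = drift E + v • B} ⊆ su N := by
    rintro _ ⟨v, rfl⟩
    have hv := smul_mem_su hB v
    exact ⟨by rw [conjTranspose_add, hA.1, hv.1, neg_add],
      by rw [trace_add, hA.2, hv.2, add_zero]⟩
  have hN : N ≠ 0 := by
    rintro rfl
    exact hconn.nonempty.elim fun i => i.elim0
  have htop := expSemigroup_eq_top hN hM fun V hV hMV hlie => by
    -- The inputs v = 0 and v = 1 already recover A and B as A and (A + B) - A.
    have hAM : drift E ∈ {M | ∃ v : ℝ, M = drift E + v • B} := ⟨0, by simp⟩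
    have hABM : drift E + B ∈ {M | ∃ v : ℝ, M = drift E + v • B} := ⟨1, by simp⟩
    refine su_subset_of_ad_invariant hE hE' hB hconn hreg V hV (hMV hAM) ?_ (hlie _ hAM) ?_
    · simpa using V.sub_mem (hMV hABM) (hMV hAM)
    · intro X hX
      have h := V.sub_mem (hlie _ hABM X hX) (hlie _ hAM X hX)
      convert h using 1
      simp only [Ring.lie_def]
      noncomm_ring
  refine Set.eq_univ_of_forall fun g => expSemigroup_subset_reachableSet hM ?_
  rw [htop]
  exact Submonoid.mem_top g

end

theorem mainTheorem6 (N : ℕ) (E : Fin N → ℝ) (hE_trace : ∑ k, E k = 0)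
    (hE_order : Monotone E) (hE_nondegenerate : ∀ i j, i ≠ j → E i ≠ E j)
    (B : Matrix (Fin N) (Fin N) ℂ) (hB : B ∈ su N) (hconn : (matrixGraph B).Connected) :
    (IsRegularDiag (diagPart B) → IsControllable (drift E) B) ∧
      (IsRegularAlong (diagPart B) ⁅drift E, B⁆ → IsControllable (drift E) B) :=
  have h := isControllable_of_isRegularAlong hE_trace hE_order hE_nondegenerate hB hconn
  ⟨fun hreg => h (hreg.isRegularAlong _), h⟩
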